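/- Let $\Omega$ be a compact connected metric graph with finitely many edges of positive length (multiple edges and loops are allowed) and with its internal (shortest path) distance $\tau$. Let $\mu(w)$ be the valence of the vertex $w$ (a loop is counted twice), and assume that no vertex has valence $2$. Vertices of valence $1$ are called boundary vertices (their set is $\Gamma$), the others interior. Fix $\gamma\in\Gamma$, put $\Omega_\gamma^t=\{x:\tau(x,\gamma)<t\}$ and $T_\gamma=\inf\{t>0:\Omega_\gamma^t=\Omega\}$. At the moment $0$ a point impulse of amplitude $1$ enters $\Omega$ from $\gamma$. Impulses move along edges with unit speed, independently of each other, and their amplitudes add up. An impulse of amplitude $a$ arriving along an edge at an interior vertex $v$ splits into a reflected impulse of amplitude $\frac{2-\mu(v)}{\mu(v)}a$ and impulses of amplitude $\frac{2}{\mu(v)}a$ leaving along each of the other edges at $v$; an impulse arriving at a boundary vertex is reflected with amplitude $-a$. Let $a(x,t)$, for $x\in\Omega$ and $t\ge 0$, be the total amplitude present at $x$ at the moment $t$ (at an interior vertex, the sum of the amplitudes of the impulses arriving there), with $a(x,t)=0$ for $x\in\Gamma$ except that $a(\gamma,0)=1$. The hydra $H_\gamma$ is the closure of $\{(x,t): a(x,t)\neq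 0\}$ in $\Omega\times[0,\infty)$. Let $T>0$ and $H_\gamma^T=H_\gamma\cap(\Omega\times[0,T])$, with projections $\pi(x,t)=x$ and $\rho(x,t)=t$. For $B\subset H_\gamma^T$ let $\mathcal L[B]$ be the union of the classes of the points of $B$ under the equivalence relation on $H_\gamma^T$ generated by: $h\sim_0 h'$ if $\pi(h)=\pi(h')$ or $\rho(h)=\rho(h')$. For $A\subset\Omega$ put $$\Lambda[A]=\pi(\mathcal L[\pi^{-1}(A)]),\qquad \Xi[A]=\rho(\mathcal L[\pi^{-1}(A)]),\qquad \Lambda[x]=\Lambda[\{x\}],$$ where $\pi^{-1}(A)\subset H_\gamma^T$. The $\alpha$-set over $A$ is the family of the functions $\alpha_t:A\to\mathbb R$, $t\in\Xi[A]$, with $\alpha_t(y)=a(y,t)$ if $(y,t)\in H_\gamma^T$ and $\alpha_t(y)=0$ otherwise; if $\Xi[A]=\{t_1<\dots<t_n\}$ is finite, these are the amplitude vectors $\alpha^i=\alpha_{t_i}$, $i=1,\dots,n$. Suppose that $0<T<T_\gamma$. Then: 1. For every $x\in\overline{\Omega_\gamma^T}$ the $\alpha$-set over the determination set $\Lambda[x]$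 is linearly independent (if it is infinite: every finite subfamily is linearly independent); in particular, if $\Xi[\Lambda[x]]=\{t_1<\dots<t_n\}$, then the vectors $\alpha^1,\dots,\alpha^n$ on $\Lambda[x]$ are linearly independent. 2. $\Xi[\overline{\Omega_\gamma^T}]=[0,T]$. -/

import Mathlib

/-- A connected metric graph with vertex set `W` and edge set `E`.  The edge `e` is a curve of
length `len e > 0` running from the vertex `ends e false` to the vertex `ends e true`.
Multiple edges and loops are allowed. -/
structure MetricGraph (W E : Type*) where
  ends : E → Bool → W
  len : E → ℝ
  len_pos : ∀ e, 0 < len e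
  connected : ∀ v w : W,
    Relation.ReflTransGen (fun a b => ∃ e i, ends e i = a ∧ ends e (!i) = b) v w

namespace MetricGraph

variable {W E : Type*}

/-- The points of the graph: the vertices and the points of the open edges; `inner e s` is the
point of `e` at distance `s` along `e` from the end `ends e false`. -/
inductive Point (G : MetricGraph W E) where
  | vertex (w : W) : Point G
  | inner (e : E) (s : ℝ) (h0 : 0 < s) (h1 : s < G.len e) : Point G

open Classical in
/-- The arc length parametrization `s ∈ [0, len e]` of the closed edge `e`. -/
noncomputable def edgePoint (G : MetricGraph W E) (e : E) (s : ℝ) : G.Point :=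
  if h : 0 < s ∧ s < G.len e then .inner e s h.1 h.2
  else if s ≤ 0 then .vertex (G.ends e false) else .vertex (G.ends e true)

/-- `G.Joins a b r`: there is a curve of length `r` from `a` to `b`, made of finitely many
pieces, each of which runs monotonically along one closed edge. -/
inductive Joins (G : MetricGraph W E) (a : G.Point) : G.Point → ℝ → Prop
  | refl : Joins G a a 0
  | step (e : E) (s s' r : ℝ) (hs : s ∈ Set.Icc 0 (G.len e)) (hs' : s' ∈ Set.Icc 0 (G.len e))
      (h : Joins G a (G.edgePoint e s) r) : Joins G a (G.edgePoint e s') (r + |s - s'|)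

theorem Joins.nonneg {G : MetricGraph W E} {a b : G.Point} {r : ℝ} (h : G.Joins a b r) :
    0 ≤ r := by
  induction h with
  | refl => exact le_rfl
  | step e s s' r hs hs' h ih => positivity

theorem Joins.trans {G : MetricGraph W E} {a b c : G.Point} {r q : ℝ} (h : G.Joins a b r)
    (h' : G.Joins b c q) : G.Joins a c (r + q) := by
  induction h' with
  | refl => simpa using h
  | step e s s' q hs hs' _ ih => rw [← add_assoc]; exact .step e s s' _ hs hs' ih

theorem Joins.symm {G : MetricGraph W E} {a b : G.Point} {r : ℝ} (h : G.Joins a b r) :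
    G.Joins b a r := by
  induction h with
  | refl => exact .refl
  | step e s s' r hs hs' _ ih =>
    have h1 := (Joins.step e s' s 0 hs' hs .refl).trans ih
    rwa [zero_add, abs_sub_comm, add_comm] at h1

theorem edgePoint_end (G : MetricGraph W E) (e : E) (i : Bool) :
    ∃ s ∈ Set.Icc 0 (G.len e), G.edgePoint e s = .vertex (G.ends e i) := by
  have h := G.len_pos e
  cases i
  · exact ⟨0, ⟨le_rfl, h.le⟩, by simp [edgePoint]⟩
  · exact ⟨G.len e, ⟨h.le, le_rfl⟩, by simp [edgePoint, h]⟩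

theorem exists_joins (G : MetricGraph W E) (a b : G.Point) : ∃ r, G.Joins a b r := by
  have hV (p : G.Point) : ∃ w r, G.Joins p (.vertex w) r := by
    cases p with
    | vertex w => exact ⟨w, 0, .refl⟩
    | inner e s h0 h1 =>
      obtain ⟨s', hs', he⟩ := G.edgePoint_end e false
      refine ⟨G.ends e false, 0 + |s - s'|, ?_⟩
      rw [← he]
      refine .step e s s' 0 ⟨h0.le, h1.le⟩ hs' ?_
      simp only [edgePoint, h0, h1, and_self, dite_true]
      exact .refl
  have hW (v w : W) : ∃ r, G.Joins (.vertex v) (.vertex w) r := by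
    induction G.connected v w with
    | refl => exact ⟨0, .refl⟩
    | tail _ h ih =>
      obtain ⟨r, hr⟩ := ih
      obtain ⟨e, i, rfl, rfl⟩ := h
      obtain ⟨s, hs, h1⟩ := G.edgePoint_end e i
      obtain ⟨s', hs', h2⟩ := G.edgePoint_end e (!i)
      have h3 := Joins.step (a := .vertex v) e s s' r hs hs' (by rw [h1]; exact hr)
      rw [h2] at h3
      exact ⟨_, h3⟩
  obtain ⟨v, r, hv⟩ := hV a
  obtain ⟨w, q, hw⟩ := hV b
  obtain ⟨p, hp⟩ := hW v w
  exact ⟨_, (hv.trans hp).trans hw.symm⟩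

theorem bddBelow_joins (G : MetricGraph W E) (a b : G.Point) :
    BddBelow {r | G.Joins a b r} := ⟨0, fun _ h => h.nonneg⟩

/-- The internal distance `τ(a, b)`: the infimum of the lengths of the curves from `a` to `b`. -/
noncomputable instance (G : MetricGraph W E) : PseudoMetricSpace G.Point where
  dist a b := sInf {r | G.Joins a b r}
  dist_self a := le_antisymm (csInf_le (G.bddBelow_joins a a) .refl)
    (Real.sInf_nonneg fun _ h => h.nonneg)
  dist_comm a b := congrArg sInf (Set.ext fun _ => ⟨Joins.symm, Joins.symm⟩)
  dist_triangle a b c := by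
    rw [← sub_le_iff_le_add]
    refine le_csInf (G.exists_joins a b) fun r hr => ?_
    rw [sub_le_comm]
    refine le_csInf (G.exists_joins b c) fun q hq => ?_
    rw [sub_le_iff_le_add']
    exact csInf_le (G.bddBelow_joins a c) (hr.trans hq)

/-! A directed edge is a pair `(e, i)`: the edge `e` run through from its end `ends e i` to its
other end. -/

def source (G : MetricGraph W E) (d : E × Bool) : W := G.ends d.1 d.2

def target (G : MetricGraph W E) (d : E × Bool) : W := G.ends d.1 (!d.2)

def reverse (d : E × Bool) : E × Bool := (d.1, !d.2)

section Dynamics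

variable [Fintype E]

open Classical in
/-- The valence `μ(w)`: the number of edges at `w`, a loop being counted twice.
The boundary vertices are those of valence `1`, the others are interior. -/
noncomputable def valence (G : MetricGraph W E) (w : W) : ℕ :=
  (Finset.univ.filter fun d : E × Bool => G.source d = w).card

open Classical in
/-- The factor that the amplitude of an impulse arriving along the directed edge `d'` acquires when
it continues along `d`: at a boundary vertex the impulse is reflected with the factor `-1`, at an
interior vertex of valence `μ` it is reflected with the factor `(2 - μ) / μ` and passes into each
of the other edges with the factor `2 / μ`. -/
noncomputable def scatter (G : MetricGraph W E) (d' d : E × Bool) : ℝ :=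
  if G.target d' = G.source d then
    if d = reverse d' then
      if G.valence (G.source d) = 1 then -1
      else (2 - (G.valence (G.source d) : ℝ)) / (G.valence (G.source d) : ℝ)
    else 2 / (G.valence (G.source d) : ℝ)
  else 0

open Classical in
/-- Total amplitude of the impulses that start along the directed edge `d` at the moment `t` after
having met exactly `n` vertices since the unit impulse left `γ` at the moment `0`. -/
noncomputable def generation (G : MetricGraph W E) (γ : W) : ℕ → E × Bool → ℝ → ℝ
  | 0, d, t => if G.source d = γ ∧ t = 0 then 1 else 0
  | n + 1, d, t => ∑ d' : E × Bool, G.scatter d' d * generation G γ n d' (t - G.len d'.1)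

/-- Only finitely many generations contribute at any given moment. -/
theorem generation_support_finite (G : MetricGraph W E) (γ : W) (d : E × Bool) (t : ℝ) :
    (Function.support fun n => G.generation γ n d t).Finite := by
  obtain ⟨m, hm, hle⟩ : ∃ m : ℝ, 0 < m ∧ ∀ e, m ≤ G.len e := by
    obtain ⟨e, he⟩ := @Finite.exists_min E _ _ ⟨d.1⟩ _ G.len
    exact ⟨G.len e, G.len_pos e, he⟩
  have key : ∀ n d t, G.generation γ n d t ≠ 0 → n * m ≤ t := by
    intro n
    induction n with
    | zero =>
      intro d t h
      simp only [generation, ne_eq, ite_eq_right_iff, not_forall] at h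
      simp [h.1.2]
    | succ n ih =>
      intro d t h
      obtain ⟨d', -, h'⟩ := Finset.exists_ne_zero_of_sum_ne_zero h
      have h1 := ih _ _ (right_ne_zero_of_mul h')
      have h2 := hle d'.1
      push_cast
      linarith
  refine (Set.finite_Iic ⌊t / m⌋₊).subset fun n hn => ?_
  exact Nat.le_floor ((le_div_iff₀ hm).2 (key n d t hn))

/-- Amplitude of the impulse that starts along the directed edge `d` at the moment `t`
(superposition of all generations; `0` if there is no impulse). -/
noncomputable def emitted (G : MetricGraph W E) (γ : W) (d : E × Bool) (t : ℝ) : ℝ :=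
  ∑ᶠ n : ℕ, G.generation γ n d t

open Classical in
/-- The amplitude `a(x, t)` at the point `x` and the moment `t` of the fundamental solution excited
by the unit impulse from `γ`.  Inside an edge it is the sum of the amplitudes of the impulses
passing `x` in the two directions, at an interior vertex it is the sum of the amplitudes of the
impulses arriving there; on the boundary it is `0`, except that `a(γ, 0) = 1`. -/
noncomputable def amplitude (G : MetricGraph W E) (γ : W) : G.Point × ℝ → ℝ
  | (.inner e s _ _, t) => G.emitted γ (e, false) (t - s) + G.emitted γ (e, true) (t - (G.len e - s))
  | (.vertex w, t) =>
    if G.valence w = 1 then (if w = γ ∧ t = 0 then 1 else 0)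
    else ∑ d ∈ Finset.univ.filter (fun d : E × Bool => G.target d = w),
      G.emitted γ d (t - G.len d.1)

/-- The hydra `H_γ`: the space-time support of the fundamental solution. -/
def hydra (G : MetricGraph W E) (γ : W) : Set (G.Point × ℝ) := tsupport (G.amplitude γ)

/-- The truncated hydra `H_γ^T`. -/
def hydraTo (G : MetricGraph W E) (γ : W) (T : ℝ) : Set (G.Point × ℝ) :=
  G.hydra γ ∩ {h | h.2 ∈ Set.Icc 0 T}

/-- Neighbors on `H_γ^T`: points with the same space or the same time projection. -/
def Neighbor (G : MetricGraph W E) (γ : W) (T : ℝ) (h h' : G.Point × ℝ) : Prop :=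
  h ∈ G.hydraTo γ T ∧ h' ∈ G.hydraTo γ T ∧ (h.1 = h'.1 ∨ h.2 = h'.2)

/-- The lattice `ℒ[B]` of a set `B ⊆ H_γ^T`: the union of the classes, with respect to the
equivalence generated by neighborhood, of the points of `B`. -/
def lattice (G : MetricGraph W E) (γ : W) (T : ℝ) (B : Set (G.Point × ℝ)) : Set (G.Point × ℝ) :=
  {h' | ∃ h ∈ B, Relation.TransGen (G.Neighbor γ T) h h'}

/-- The lattice `ℒ[π⁻¹(A)]`, where `π⁻¹(A)` is the set of the points of `H_γ^T` over `A`. -/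
def latticeOver (G : MetricGraph W E) (γ : W) (T : ℝ) (A : Set G.Point) : Set (G.Point × ℝ) :=
  G.lattice γ T {h ∈ G.hydraTo γ T | h.1 ∈ A}

/-- The determination set `Λ[A] = π(ℒ[π⁻¹(A)])`. -/
def determinationSet (G : MetricGraph W E) (γ : W) (T : ℝ) (A : Set G.Point) : Set G.Point :=
  Prod.fst '' G.latticeOver γ T A

/-- The set of moments `Ξ[A] = ρ(ℒ[π⁻¹(A)])`. -/
def timeSet (G : MetricGraph W E) (γ : W) (T : ℝ) (A : Set G.Point) : Set ℝ :=
  Prod.snd '' G.latticeOver γ T A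

open Classical in
/-- The `α`-set over `A`: to each moment `t ∈ Ξ[A]` corresponds the function on `A` whose value at
`x` is the amplitude `a(x, t)` if `(x, t)` lies on the hydra `H_γ^T`, and `0` otherwise. -/
noncomputable def amplitudeVector (G : MetricGraph W E) (γ : W) (T : ℝ) (A : Set G.Point)
    (t : G.timeSet γ T A) (x : A) : ℝ :=
  if ((x : G.Point), (t : ℝ)) ∈ G.hydraTo γ T then G.amplitude γ (x, t) else 0

end Dynamics

/-- The filling time `T_γ = inf {t > 0 | Ω_γ^t = Ω}`. -/
noncomputable def fillingTime (G : MetricGraph W E) (γ : W) : ℝ :=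
  sInf {t : ℝ | 0 < t ∧ Metric.ball (Point.vertex γ : G.Point) t = Set.univ}

end MetricGraph

namespace MetricGraph

variable {W E : Type*}

/-! The wave front carries no cancellation. Before its first arrival time a point has amplitude `0`.
An impulse reaching a vertex at the first arrival time and going on along any edge other than the
one it came by is multiplied by `2 / μ > 0`, so simultaneous front impulses add up to a positive
amplitude. Reflection, the only source of negative factors, comes too late to matter. Since `T <
T_γ`, some point is farther than `T` from `γ`; following a shortest route towards it shows that at
every `t ∈ [0, T]` the front stands at some point `p t` (`exists_isFront`). This gives the second
claim. For the first, `p t` lies in `Λ[x]` because it shares the time `t` with a point of the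
lattice, and `α_s (p t) = 0` for `s < t` while `α_t (p t) > 0`: the `α`-set is triangular
(`linearIndependent_of_triangular`). -/

/-! ### Distances along directed edges. -/

theorem dist_edgePoint_le (G : MetricGraph W E) (e : E) {s s' : ℝ}
    (hs : s ∈ Set.Icc 0 (G.len e)) (hs' : s' ∈ Set.Icc 0 (G.len e)) :
    dist (G.edgePoint e s) (G.edgePoint e s') ≤ |s - s'| :=
  csInf_le (G.bddBelow_joins _ _) (by simpa using Joins.step e s s' 0 hs hs' .refl)

/-- The point at distance `s` from the source of the directed edge `d`. -/
noncomputable def along (G : MetricGraph W E) (d : E × Bool) (s : ℝ) : G.Point :=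
  G.edgePoint d.1 (if d.2 then G.len d.1 - s else s)

theorem along_zero (G : MetricGraph W E) (d : E × Bool) :
    G.along d 0 = .vertex (G.source d) := by
  obtain ⟨e, _ | _⟩ := d <;> simp [along, edgePoint, source, G.len_pos e]

theorem along_len (G : MetricGraph W E) (d : E × Bool) :
    G.along d (G.len d.1) = .vertex (G.target d) := by
  obtain ⟨e, _ | _⟩ := d <;> simp [along, edgePoint, target, G.len_pos e]

theorem dist_along_le (G : MetricGraph W E) (d : E × Bool) {s s' : ℝ}
    (hs : s ∈ Set.Icc 0 (G.len d.1)) (hs' : s' ∈ Set.Icc 0 (G.len d.1)) :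
    dist (G.along d s) (G.along d s') ≤ |s - s'| := by
  obtain ⟨h0, h1⟩ := hs
  obtain ⟨h0', h1'⟩ := hs'
  obtain ⟨e, _ | _⟩ := d
  · simpa [along] using G.dist_edgePoint_le e ⟨h0, h1⟩ ⟨h0', h1'⟩
  · have := G.dist_edgePoint_le e (s := G.len e - s) (s' := G.len e - s')
      ⟨sub_nonneg.2 h1, sub_le_self _ h0⟩ ⟨sub_nonneg.2 h1', sub_le_self _ h0'⟩
    rw [sub_sub_sub_cancel_left, abs_sub_comm] at this
    simpa [along] using this

theorem dist_target_le (G : MetricGraph W E) (p : G.Point) (d : E × Bool) :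
    dist p (.vertex (G.target d)) ≤ dist p (.vertex (G.source d)) + G.len d.1 := by
  have h := G.len_pos d.1
  have h1 := G.dist_along_le d (s := 0) (s' := G.len d.1) ⟨le_rfl, h.le⟩ ⟨h.le, le_rfl⟩
  rw [along_zero, along_len, zero_sub, abs_neg, abs_of_pos h] at h1
  linarith [dist_triangle p (.vertex (G.source d)) (.vertex (G.target d))]

theorem along_mem_closure_ball (G : MetricGraph W E) (p : G.Point) (d : E × Bool) {s t : ℝ}
    (h0 : 0 < s) (h1 : s ≤ G.len d.1) (hd : dist p (.vertex (G.source d)) + s ≤ t) :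
    G.along d s ∈ closure (Metric.ball p t) := by
  rw [Metric.mem_closure_iff]
  intro ε hε
  -- The ball is open, so `along d s` itself may lie on its rim. A point slightly nearer the source
  -- is strictly inside; the maximum with `0` keeps it on the edge.
  set q := max 0 (s - ε / 2) with hq
  have hq0 : 0 ≤ q := le_max_left _ _
  have hqs : q < s := max_lt h0 (by linarith)
  have hqε : s - ε / 2 ≤ q := le_max_right _ _
  refine ⟨G.along d q, ?_, ?_⟩
  · have h2 := G.dist_along_le d (s := 0) (s' := q) ⟨le_rfl, h0.le.trans h1⟩
      ⟨hq0, hqs.le.trans h1⟩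
    rw [along_zero, zero_sub, abs_neg, abs_of_nonneg hq0] at h2
    rw [Metric.mem_ball, dist_comm]
    linarith [dist_triangle p (.vertex (G.source d)) (G.along d q)]
  · have h2 := G.dist_along_le d (s := s) (s' := q) ⟨h0.le, h1⟩ ⟨hq0, hqs.le.trans h1⟩
    rw [abs_of_pos (sub_pos.2 hqs)] at h2
    linarith

@[simp] theorem source_reverse (G : MetricGraph W E) (d : E × Bool) :
    G.source (reverse d) = G.target d := rfl

@[simp] theorem target_reverse (G : MetricGraph W E) (d : E × Bool) :
    G.target (reverse d) = G.source d := by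
  simp [target, source, reverse]

@[simp] theorem reverse_fst (d : E × Bool) : (reverse d).1 = d.1 := rfl

/-! ### First arrival times as the largest potential. -/

/-- `f` vanishes at `γ` and increases along every directed edge by at most its length. -/
def IsPotential (G : MetricGraph W E) (γ : W) (f : W → ℝ) : Prop :=
  f γ = 0 ∧ ∀ d, f (G.target d) ≤ f (G.source d) + G.len d.1

theorem isPotential_dist (G : MetricGraph W E) (γ : W) :
    G.IsPotential γ fun w => dist (.vertex γ : G.Point) (.vertex w) :=
  ⟨dist_self _, fun d => G.dist_target_le _ d⟩

/-- The first arrival time at a vertex of the impulses emitted from `γ` at the moment `0`: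
the largest potential. -/
noncomputable def arrival (G : MetricGraph W E) (γ w : W) : ℝ :=
  sSup {r | ∃ f, G.IsPotential γ f ∧ f w = r}

/-- The length of any edge path from `γ` to `w` is a bound, by connectedness. -/
theorem bddAbove_potential (G : MetricGraph W E) (γ w : W) :
    BddAbove {r | ∃ f, G.IsPotential γ f ∧ f w = r} := by
  induction G.connected γ w with
  | refl => exact ⟨0, by rintro _ ⟨f, hf, rfl⟩; exact hf.1.le⟩
  | tail _ h ih =>
    obtain ⟨C, hC⟩ := ih
    obtain ⟨e, i, rfl, rfl⟩ := h
    refine ⟨C + G.len e, ?_⟩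
    rintro _ ⟨f, hf, rfl⟩
    exact (hf.2 (e, i)).trans (add_le_add_left (hC ⟨f, hf, rfl⟩) _)

theorem IsPotential.le_arrival {G : MetricGraph W E} {γ : W} {f : W → ℝ}
    (hf : G.IsPotential γ f) (w : W) : f w ≤ G.arrival γ w :=
  le_csSup (G.bddAbove_potential γ w) ⟨f, hf, rfl⟩

theorem arrival_le (G : MetricGraph W E) (γ w : W) {r : ℝ}
    (h : ∀ f, G.IsPotential γ f → f w ≤ r) : G.arrival γ w ≤ r :=
  csSup_le ⟨_, _, G.isPotential_dist γ, rfl⟩ (by rintro _ ⟨f, hf, rfl⟩; exact h f hf)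

theorem isPotential_arrival (G : MetricGraph W E) (γ : W) : G.IsPotential γ (G.arrival γ) := by
  refine ⟨le_antisymm (G.arrival_le γ γ fun f hf => hf.1.le) ?_, fun d => ?_⟩
  · simpa using (G.isPotential_dist γ).le_arrival γ
  · exact G.arrival_le γ _ fun f hf => (hf.2 d).trans (add_le_add_left (hf.le_arrival _) _)

theorem arrival_self (G : MetricGraph W E) (γ : W) : G.arrival γ γ = 0 :=
  (G.isPotential_arrival γ).1

theorem arrival_target_le (G : MetricGraph W E) (γ : W) (d : E × Bool) :
    G.arrival γ (G.target d) ≤ G.arrival γ (G.source d) + G.len d.1 :=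
  (G.isPotential_arrival γ).2 d

theorem dist_le_arrival (G : MetricGraph W E) (γ w : W) :
    dist (.vertex γ : G.Point) (.vertex w) ≤ G.arrival γ w :=
  (G.isPotential_dist γ).le_arrival w

open Filter Topology in
-- Maximality: if no edge into `w` were tight, the potential could be raised slightly at `w` alone.
-- The tight edge is the last edge of a shortest route.
theorem exists_arrival_eq [Finite E] (G : MetricGraph W E) {γ w : W} (hw : w ≠ γ) :
    ∃ d, G.target d = w ∧ G.arrival γ w = G.arrival γ (G.source d) + G.len d.1 := by
  classical
  by_contra! H
  have hlt (d) (hd : G.target d = w) :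
      G.arrival γ w < G.arrival γ (G.source d) + G.len d.1 :=
    lt_of_le_of_ne (hd ▸ G.arrival_target_le γ d) (H d hd)
  have hev : ∀ᶠ ε : ℝ in 𝓝[>] 0, ∀ d, G.target d = w →
      G.arrival γ w + ε < G.arrival γ (G.source d) + G.len d.1 := by
    rw [eventually_all]
    intro d
    by_cases hd : G.target d = w
    · filter_upwards [Ioo_mem_nhdsGT (sub_pos.2 (hlt d hd))] with ε hε _
      linarith [hε.2]
    · exact Eventually.of_forall fun _ h => absurd h hd
  obtain ⟨ε, hε, hε0⟩ := (hev.and self_mem_nhdsWithin).exists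
  have hε0 : 0 < ε := hε0
  have hup (v) : G.arrival γ v ≤ Function.update (G.arrival γ) w (G.arrival γ w + ε) v := by
    by_cases hv : v = w
    · subst hv; simp [hε0.le]
    · simp [hv]
  have hP : G.IsPotential γ (Function.update (G.arrival γ) w (G.arrival γ w + ε)) := by
    refine ⟨by rw [Function.update_of_ne hw.symm, arrival_self], fun d => ?_⟩
    refine le_trans ?_ (add_le_add_left (hup _) _)
    by_cases hd : G.target d = w
    · rw [hd, Function.update_self]
      exact (hε d hd).le
    · rw [Function.update_of_ne hd]
      exact G.arrival_target_le γ d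
  have := hP.le_arrival w
  rw [Function.update_self] at this
  linarith

/-- The first impulse arriving at the source of `d` does not arrive along `d`. -/
def Forward (G : MetricGraph W E) (γ : W) (d : E × Bool) : Prop :=
  G.arrival γ (G.source d) < G.arrival γ (G.target d) + G.len d.1

theorem Forward.of_eq {G : MetricGraph W E} {γ : W} {d' d : E × Bool}
    (h : G.target d' = G.source d)
    (he : G.arrival γ (G.source d) = G.arrival γ (G.source d') + G.len d'.1) :
    G.Forward γ d' := by
  unfold Forward
  rw [h]
  linarith [G.len_pos d'.1]

theorem Forward.ne_reverse {G : MetricGraph W E} {γ : W} {d' d : E × Bool}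
    (hd : G.Forward γ d)
    (he : G.arrival γ (G.source d) = G.arrival γ (G.source d') + G.len d'.1) :
    d ≠ reverse d' := by
  rintro rfl
  unfold Forward at hd
  rw [target_reverse, reverse_fst] at hd
  linarith

theorem wellFounded_arrival [Finite W] (G : MetricGraph W E) (γ : W) :
    WellFounded fun v w => G.arrival γ v < G.arrival γ w :=
  have : IsTrans W fun v w => G.arrival γ v < G.arrival γ w := ⟨fun _ _ _ => lt_trans⟩
  have : Std.Irrefl fun v w => G.arrival γ v < G.arrival γ w := ⟨fun _ => lt_irrefl _⟩
  Finite.wellFounded_of_trans_of_irrefl _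

theorem exists_lt_dist_of_lt_fillingTime (G : MetricGraph W E) (γ : W) {T : ℝ} (hT0 : 0 < T)
    (hT : T < G.fillingTime γ) : ∃ y : G.Point, T < dist (.vertex γ) y := by
  -- If all distances were at most `T`, the open ball of radius `T` might still miss points, but
  -- that of radius `T' > T` would not.
  obtain ⟨T', h1, h2⟩ := exists_between hT
  by_contra! H
  refine (csInf_le ⟨0, fun t ht => ht.1.le⟩ ?_ : G.fillingTime γ ≤ T').not_gt h2
  refine ⟨hT0.trans h1, Set.eq_univ_of_forall fun y => ?_⟩
  rw [Metric.mem_ball, dist_comm]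
  exact (H y).trans_lt h1

/-! ### Vanishing before the front, positivity on it. -/

section Dynamics

variable [Fintype E]

theorem arrival_le_of_generation_ne_zero (G : MetricGraph W E) (γ : W) (n : ℕ) (d : E × Bool)
    (t : ℝ) (h : G.generation γ n d t ≠ 0) : G.arrival γ (G.source d) ≤ t := by
  induction n generalizing d t with
  | zero =>
    simp only [generation, ne_eq, ite_eq_right_iff, not_forall] at h
    rw [h.1.1, h.1.2, arrival_self]
  | succ n ih =>
    obtain ⟨d', -, h'⟩ := Finset.exists_ne_zero_of_sum_ne_zero h
    have h1 := ih _ _ (right_ne_zero_of_mul h')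
    have h2 : G.target d' = G.source d := by
      by_contra h2
      exact left_ne_zero_of_mul h' (by simp [scatter, h2])
    rw [← h2]
    linarith [G.arrival_target_le γ d']

theorem emitted_eq_zero (G : MetricGraph W E) (γ : W) (d : E × Bool) {t : ℝ}
    (h : t < G.arrival γ (G.source d)) : G.emitted γ d t = 0 :=
  (finsum_congr fun n => by
    by_contra h0
    exact h.not_ge (G.arrival_le_of_generation_ne_zero γ n d t h0)).trans finsum_zero

theorem valence_source_pos (G : MetricGraph W E) (d : E × Bool) : 0 < G.valence (G.source d) :=
  Finset.card_pos.2 ⟨d, by simp⟩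

theorem scatter_pos (G : MetricGraph W E) {d' d : E × Bool} (h : G.target d' = G.source d)
    (hr : d ≠ reverse d') : 0 < G.scatter d' d := by
  have := G.valence_source_pos d
  simp only [scatter, h, hr, if_true, if_false]
  positivity

/-- At the first arrival time only tight edges into the source of `d` can contribute. They are
forward themselves, and `d` reverses none of them, so the negative reflection factor never occurs.
-/
theorem Forward.scatter_mul_generation_nonneg {G : MetricGraph W E} {γ : W} {d : E × Bool}
    (hd : G.Forward γ d) {n : ℕ}
    (ih : ∀ d', G.Forward γ d' → 0 ≤ G.generation γ n d' (G.arrival γ (G.source d')))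
    (d' : E × Bool) :
    0 ≤ G.scatter d' d * G.generation γ n d' (G.arrival γ (G.source d) - G.len d'.1) := by
  by_cases h : G.target d' = G.source d
  · have hle := G.arrival_target_le γ d'
    rw [h] at hle
    rcases hle.lt_or_eq with hlt | he
    · have : G.generation γ n d' (G.arrival γ (G.source d) - G.len d'.1) = 0 := by
        by_contra h0
        linarith [G.arrival_le_of_generation_ne_zero γ n d' _ h0]
      simp [this]
    · rw [he, add_sub_cancel_right]
      exact mul_nonneg (G.scatter_pos h (hd.ne_reverse he)).le (ih d' (.of_eq h he))
  · simp [scatter, h]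

theorem Forward.generation_nonneg {G : MetricGraph W E} {γ : W} (n : ℕ) {d : E × Bool}
    (hd : G.Forward γ d) : 0 ≤ G.generation γ n d (G.arrival γ (G.source d)) := by
  induction n generalizing d with
  | zero =>
    simp only [generation]
    split_ifs <;> simp
  | succ n ih =>
    exact Finset.sum_nonneg fun d' _ =>
      hd.scatter_mul_generation_nonneg (fun d' hd' => ih hd') d'

theorem Forward.exists_generation_pos [Finite W] {G : MetricGraph W E} {γ : W} {d : E × Bool}
    (hd : G.Forward γ d) : ∃ n, 0 < G.generation γ n d (G.arrival γ (G.source d)) := by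
  obtain ⟨w, hw⟩ : ∃ w, G.source d = w := ⟨_, rfl⟩
  induction w using (G.wellFounded_arrival γ).induction generalizing d with
  | _ w ih =>
    by_cases hγ : w = γ
    · refine ⟨0, ?_⟩
      subst hγ
      simp [generation, hw, arrival_self]
    · obtain ⟨d', h, he⟩ := G.exists_arrival_eq hγ
      rw [← hw] at h he
      have hf : G.Forward γ d' := .of_eq h he
      obtain ⟨n, hn⟩ := ih (G.source d')
        (by rw [← hw]; linarith [G.len_pos d'.1]) hf rfl
      refine ⟨n + 1, Finset.sum_pos' (fun d' _ => hd.scatter_mul_generation_nonneg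
        (fun d' hd' => hd'.generation_nonneg n) d') ⟨d', Finset.mem_univ _, ?_⟩⟩
      rw [he, add_sub_cancel_right]
      exact mul_pos (G.scatter_pos h (hd.ne_reverse he)) hn

theorem Forward.emitted_pos [Finite W] {G : MetricGraph W E} {γ : W} {d : E × Bool}
    (hd : G.Forward γ d) : 0 < G.emitted γ d (G.arrival γ (G.source d)) :=
  finsum_pos (fun n => hd.generation_nonneg n) hd.exists_generation_pos
    (G.generation_support_finite γ d _)

theorem Forward.emitted_nonneg [Finite W] {G : MetricGraph W E} {γ : W} {d : E × Bool}
    (hd : G.Forward γ d) {t : ℝ} (ht : t ≤ G.arrival γ (G.source d)) :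
    0 ≤ G.emitted γ d t := by
  rcases ht.lt_or_eq with h | rfl
  · exact (G.emitted_eq_zero γ d h).ge
  · exact hd.emitted_pos.le

theorem amplitude_along (G : MetricGraph W E) (γ : W) (d : E × Bool) {s : ℝ} (h0 : 0 < s)
    (h1 : s < G.len d.1) (t : ℝ) :
    G.amplitude γ (G.along d s, t) =
      G.emitted γ d (t - s) + G.emitted γ (reverse d) (t - (G.len d.1 - s)) := by
  obtain ⟨e, _ | _⟩ := d
  · simp [along, edgePoint, amplitude, h0, h1, reverse]
  · simp [along, edgePoint, amplitude, h0, h1, reverse, add_comm]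

/-! ### The wave front at each moment. -/

/-- The wave front is at `x` at the moment `t`. -/
structure IsFront (G : MetricGraph W E) (γ : W) (x : G.Point) (t : ℝ) : Prop where
  pos : 0 < G.amplitude γ (x, t)
  eq_zero : ∀ s < t, G.amplitude γ (x, s) = 0
  mem_closure : ∀ r ≥ t, 0 < r → x ∈ closure (Metric.ball (.vertex γ) r)

theorem isFront_source (G : MetricGraph W E) {γ : W} (hγ : G.valence γ = 1) :
    G.IsFront γ (.vertex γ) 0 where
  pos := by simp [amplitude, hγ]
  eq_zero s hs := by simp [amplitude, hγ, hs.ne]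
  -- At time `0` the ball of radius `t` is empty, hence the demand `0 < r`.
  mem_closure r _ hr := subset_closure (Metric.mem_ball_self hr)

theorem isFront_along [Finite W] (G : MetricGraph W E) (γ : W) (d : E × Bool) {s : ℝ}
    (h0 : 0 < s) (h1 : s < G.len d.1)
    (h : G.arrival γ (G.source d) + s ≤ G.arrival γ (G.target d) + (G.len d.1 - s)) :
    G.IsFront γ (G.along d s) (G.arrival γ (G.source d) + s) where
  pos := by
    have hd : G.Forward γ d := by unfold Forward; linarith
    have hr : 0 ≤ G.emitted γ (reverse d)
        (G.arrival γ (G.source d) + s - (G.len d.1 - s)) := by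
      -- Equality is the case of two fronts meeting inside the edge; the opposite one is then
      -- forward too, and the amplitudes add.
      rcases h.lt_or_eq with hlt | he
      · exact (G.emitted_eq_zero γ _ (by rw [source_reverse]; linarith)).ge
      · refine Forward.emitted_nonneg ?_ (by rw [source_reverse]; linarith)
        unfold Forward
        rw [source_reverse, target_reverse, reverse_fst]
        linarith
    rw [G.amplitude_along γ d h0 h1, add_sub_cancel_right]
    exact add_pos_of_pos_of_nonneg hd.emitted_pos hr
  eq_zero t ht := by
    rw [G.amplitude_along γ d h0 h1, G.emitted_eq_zero γ d (by linarith),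
      G.emitted_eq_zero γ _ (by rw [source_reverse]; linarith), add_zero]
  mem_closure r hr _ := G.along_mem_closure_ball _ d h0 h1.le
    (by linarith [G.dist_le_arrival γ (G.source d)])

theorem isFront_vertex [Finite W] (G : MetricGraph W E) {γ : W} {d : E × Bool}
    (h0 : G.source d ≠ γ) (hd : G.Forward γ d) :
    G.IsFront γ (.vertex (G.source d)) (G.arrival γ (G.source d)) := by
  classical
  obtain ⟨d', h, he⟩ := G.exists_arrival_eq h0
  -- On the boundary the amplitude would be `0`. But the edge of first arrival and the forward edge
  -- `d` give two different directed edges out of this vertex.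
  have hval : G.valence (G.source d) ≠ 1 := by
    intro h1
    obtain ⟨c, hc⟩ := Finset.card_eq_one.1 h1
    have hm (b) (hb : G.source b = G.source d) : b = c := by
      have : b ∈ Finset.univ.filter fun b : E × Bool => G.source b = G.source d := by simp [hb]
      rw [hc] at this
      exact Finset.mem_singleton.1 this
    exact hd.ne_reverse he ((hm d rfl).trans (hm (reverse d') (by simp [h])).symm)
  refine ⟨?_, fun s hs => ?_, fun r hr _ => ?_⟩
  · simp only [amplitude, hval, if_false]
    refine Finset.sum_pos' (fun b hb => ?_) ⟨d', by simp [h], ?_⟩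
    · have hb : G.target b = G.source d := by simpa using hb
      have hle := G.arrival_target_le γ b
      rw [hb] at hle
      rcases hle.lt_or_eq with hlt | hbe
      · exact (G.emitted_eq_zero γ b (by linarith)).ge
      · exact (Forward.of_eq hb hbe).emitted_nonneg (by linarith)
    · rw [he, add_sub_cancel_right]
      exact (Forward.of_eq h he).emitted_pos
  · simp only [amplitude, hval, if_false]
    refine Finset.sum_eq_zero fun b hb => G.emitted_eq_zero γ b ?_
    have hb : G.target b = G.source d := by simpa using hb
    have hle := G.arrival_target_le γ b
    rw [hb] at hle
    linarith
  · rw [← h, ← along_len]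
    refine G.along_mem_closure_ball _ d' (G.len_pos _) le_rfl ?_
    linarith [G.dist_le_arrival γ (G.source d')]

theorem Forward.exists_isFront [Finite W] {G : MetricGraph W E} {γ : W} {d : E × Bool} {t : ℝ}
    (ht : 0 < t) (hd : G.arrival γ (G.source d) = t) (hf : G.Forward γ d) :
    ∃ x, G.IsFront γ x t := by
  refine ⟨.vertex (G.source d), hd ▸ G.isFront_vertex ?_ hf⟩
  intro h
  rw [h, arrival_self] at hd
  exact ht.ne hd

/-- Go back from `w` along tight edges, with decreasing arrival times, until the moment `t` falls on
the current edge or its source. -/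
theorem exists_isFront_of_lt_arrival [Finite W] (G : MetricGraph W E) (γ : W) {t : ℝ}
    (ht : 0 < t) (w : W) (hw : t < G.arrival γ w) : ∃ x, G.IsFront γ x t := by
  induction w using (G.wellFounded_arrival γ).induction with
  | _ w ih =>
    have hγ : w ≠ γ := by
      rintro rfl
      rw [arrival_self] at hw
      exact hw.not_gt ht
    obtain ⟨d, rfl, he⟩ := G.exists_arrival_eq hγ
    have hl := G.len_pos d.1
    rcases lt_trichotomy (G.arrival γ (G.source d)) t with h | h | h
    · have := G.isFront_along γ d (s := t - G.arrival γ (G.source d)) (by linarith) (by linarith)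
        (by linarith)
      rw [add_sub_cancel] at this
      exact ⟨_, this⟩
    · exact Forward.exists_isFront ht h (by unfold Forward; linarith)
    · exact ih (G.source d) (by linarith) h

theorem exists_isFront [Finite W] (G : MetricGraph W E) {γ : W} (hγ : G.valence γ = 1)
    {t : ℝ} (ht : 0 ≤ t) {y : G.Point} (hy : t < dist (.vertex γ) y) :
    ∃ x, G.IsFront γ x t := by
  rcases ht.eq_or_lt with rfl | ht
  · exact ⟨_, G.isFront_source hγ⟩
  cases y with
  | vertex w => exact G.exists_isFront_of_lt_arrival γ ht w (hy.trans_le (G.dist_le_arrival γ w))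
  | inner e s h0 h1 =>
    have hp : G.along (e, false) s = .inner e s h0 h1 := by simp [along, edgePoint, h0, h1]
    have hsrc : t < G.arrival γ (G.source (e, false)) + s := by
      have := G.dist_along_le (e, false) (s := 0) (s' := s) ⟨le_rfl, h0.le.trans h1.le⟩
        ⟨h0.le, h1.le⟩
      rw [along_zero, hp, zero_sub, abs_neg, abs_of_pos h0] at this
      linarith [dist_triangle (.vertex γ) (.vertex (G.source (e, false)))
        (Point.inner e s h0 h1), G.dist_le_arrival γ (G.source (e, false))]
    have htgt : t < G.arrival γ (G.target (e, false)) + (G.len e - s) := by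
      have := G.dist_along_le (e, false) (s := G.len e) (s' := s) ⟨h0.le.trans h1.le, le_rfl⟩
        ⟨h0.le, h1.le⟩
      have hl := G.along_len (e, false)
      simp only at hl
      rw [hl, hp, abs_of_pos (sub_pos.2 h1)] at this
      linarith [dist_triangle (.vertex γ) (.vertex (G.target (e, false)))
        (Point.inner e s h0 h1), G.dist_le_arrival γ (G.target (e, false))]
    -- Adding `hsrc` and `htgt` shows that fronts from the two ends have not yet passed each other
    -- at time `t`, so a front inside the edge is still a first arrival.
    rcases lt_trichotomy (G.arrival γ (G.source (e, false))) t with h | h | h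
    · have := G.isFront_along γ (e, false) (s := t - G.arrival γ (G.source (e, false)))
        (by linarith) (by simp only; linarith) (by simp only; linarith)
      rw [add_sub_cancel] at this
      exact ⟨_, this⟩
    · exact Forward.exists_isFront ht h (by unfold Forward; simp only; linarith)
    · exact G.exists_isFront_of_lt_arrival γ ht _ h

/-! ### Lattices. -/

theorem IsFront.mem_hydraTo {G : MetricGraph W E} {γ : W} {x : G.Point} {t T : ℝ}
    (h : G.IsFront γ x t) (ht : t ∈ Set.Icc 0 T) : (x, t) ∈ G.hydraTo γ T :=
  ⟨subset_tsupport _ h.pos.ne', ht⟩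

theorem latticeOver_subset_hydraTo (G : MetricGraph W E) (γ : W) (T : ℝ) (A : Set G.Point) :
    G.latticeOver γ T A ⊆ G.hydraTo γ T := by
  rintro h ⟨k, -, hk⟩
  obtain ⟨_, -, hn⟩ := Relation.TransGen.tail'_iff.1 hk
  exact hn.2.1

theorem mem_latticeOver_of_neighbor {G : MetricGraph W E} {γ : W} {T : ℝ} {A : Set G.Point}
    {h h' : G.Point × ℝ} (hh : h ∈ G.latticeOver γ T A) (hn : G.Neighbor γ T h h') :
    h' ∈ G.latticeOver γ T A := by
  obtain ⟨k, hk, hkh⟩ := hh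
  exact ⟨k, hk, hkh.tail hn⟩

/-- A hydra point over `Λ[A]` is a space neighbor of a lattice point, so iterating adds nothing.
Thus times in `Ξ[Λ[x]]` already occur in the lattice of `x`. -/
theorem latticeOver_determinationSet (G : MetricGraph W E) (γ : W) (T : ℝ) (A : Set G.Point) :
    G.latticeOver γ T (G.determinationSet γ T A) ⊆ G.latticeOver γ T A := by
  rintro h ⟨k, ⟨hk, l, hl, hlk⟩, hkh⟩
  obtain ⟨m, hm, hml⟩ := mem_latticeOver_of_neighbor hl
    ⟨G.latticeOver_subset_hydraTo γ T A hl, hk, Or.inl hlk⟩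
  exact ⟨m, hm, hml.trans hkh⟩

end Dynamics

end MetricGraph

/-! ### Triangular families and the theorem. -/

/-- Functions indexed by a linear order that are triangular with respect to some choice of
points are linearly independent. -/
theorem linearIndependent_of_triangular {ι X K : Type*} [LinearOrder ι] [Field K]
    (v : ι → X → K) (p : ι → X) (hp : ∀ i, v i (p i) ≠ 0) (hlt : ∀ i j, i < j → v i (p j) = 0) :
    LinearIndependent K v := by
  rw [linearIndependent_iff']
  intro s g hg
  classical
  by_contra! H
  obtain ⟨i, his, hi⟩ := H
  have hne : (s.filter fun i => g i ≠ 0).Nonempty := ⟨i, by simp [his, hi]⟩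
  -- Evaluated at `p m`, with `m` the last index of nonzero coefficient, the relation keeps only its
  -- `m`-th term.
  set m := (s.filter fun i => g i ≠ 0).max' hne with hm
  obtain ⟨hms, hgm⟩ := Finset.mem_filter.1 (Finset.max'_mem _ hne)
  have h := congrFun hg (p m)
  rw [Finset.sum_apply, Finset.sum_eq_single_of_mem m hms] at h
  · exact mul_ne_zero hgm (hp m) h
  · intro j hj hjm
    by_cases hgj : g j = 0
    · simp [hgj]
    · have hle : j ≤ m := Finset.le_max' _ _ (by simp [hj, hgj])
      simp [hlt j m (lt_of_le_of_ne hle hjm)]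

theorem lemma1 {W E : Type*} [Finite W] [Fintype E] (G : MetricGraph W E)
    (hG : ∀ w, G.valence w ≠ 2) (γ : W) (hγ : G.valence γ = 1)
    (T : ℝ) (hT0 : 0 < T) (hT : T < G.fillingTime γ) :
    (∀ x ∈ closure (Metric.ball (MetricGraph.Point.vertex γ : G.Point) T),
      LinearIndependent ℝ (G.amplitudeVector γ T (G.determinationSet γ T {x}))) ∧
    G.timeSet γ T (closure (Metric.ball (MetricGraph.Point.vertex γ : G.Point) T)) =
      Set.Icc 0 T := by

  obtain ⟨y, hy⟩ := G.exists_lt_dist_of_lt_fillingTime γ hT0 hT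
  have hF (t : ℝ) (ht : t ∈ Set.Icc 0 T) : ∃ x, G.IsFront γ x t :=
    G.exists_isFront hγ ht.1 (ht.2.trans_lt hy)
  refine ⟨fun x _ => ?_, Set.Subset.antisymm ?_ fun t ht => ?_⟩
  · have key (t : G.timeSet γ T (G.determinationSet γ T {x})) :
        ∃ p : G.determinationSet γ T {x}, G.IsFront γ p t ∧ (t : ℝ) ∈ Set.Icc 0 T := by
      obtain ⟨_, h, hh, rfl⟩ := t
      have hl := G.latticeOver_determinationSet γ T {x} hh
      have hH := G.latticeOver_subset_hydraTo γ T _ hl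
      obtain ⟨p, hp⟩ := hF h.2 hH.2
      -- The front point at the time of `h` is a time neighbor of `h`, so it lies over `Λ[x]`.
      exact ⟨⟨p, _, MetricGraph.mem_latticeOver_of_neighbor hl
        ⟨hH, hp.mem_hydraTo hH.2, Or.inr rfl⟩, rfl⟩, hp, hH.2⟩
    choose p hp ht using key
    refine linearIndependent_of_triangular _ p (fun t => ?_) fun s t hst => ?_
    · rw [MetricGraph.amplitudeVector, if_pos ((hp t).mem_hydraTo (ht t))]
      exact (hp t).pos.ne'
    · rw [MetricGraph.amplitudeVector, (hp t).eq_zero s hst, ite_self]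
  · rintro _ ⟨h, hh, rfl⟩
    exact (G.latticeOver_subset_hydraTo γ T _ hh).2
  · obtain ⟨x, hx⟩ := hF t ht
    have hH := hx.mem_hydraTo ht
    exact ⟨(x, t), ⟨(x, t), ⟨hH, hx.mem_closure T ht.2 hT0⟩, .single ⟨hH, hH, Or.inl rfl⟩⟩, rfl⟩
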